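/- Let $Y_1, Y_2, \dots$ be independent, identically distributed, almost surely nonnegative real random variables (the hop lengths) with $E[Y_1^2] < \infty$, and suppose that their common law is non-arithmetic, i.e. there is no $d > 0$ such that $Y_1 \in d\mathbb{Z}$ almost surely (in particular $Y_1$ is not almost surely $0$, so $E[Y_1] > 0$; every law with a density is non-arithmetic). For $x \in \mathbb{R}$ let $M(x) = \min\{n \ge 0 : Y_1 + \dots + Y_n > x\}$ (with $\min\emptyset = \infty$) and $N(x) = E[M(x)]$. Then $N(x) < \infty$ for every $x$, and $\bar N(x) = \frac{x}{E[Y_1]} + \frac{E[Y_1^2]}{2E[Y_1]^2}$ is the linear approximation of $N(x)$ for large $x$, in the sense that $$\lim_{x \to \infty}\left( N(x) - \frac{x}{E[Y_1]} \right) = \frac{E[Y_1^2]}{2\,E[Y_1]^2}.$$ -/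

import Mathlib

open MeasureTheory ProbabilityTheory Filter Topology
open scoped ENNReal

noncomputable section

/-- The first-passage count `M(x) = min {n : Y₁ + ⋯ + Yₙ > x}`, where the hop lengths
`Y₁, Y₂, …` are `Y 0, Y 1, …`; it is `∞` when no partial sum exceeds `x`. -/
def firstPassageCount {Ω : Type*} (Y : ℕ → Ω → ℝ) (x : ℝ) (ω : Ω) : ℕ∞ :=
  ⨅ (n : ℕ) (_ : x < ∑ i ∈ Finset.range n, Y i ω), (n : ℕ∞)

/-- The expected first-passage count `N(x) = E[M(x)]`, with values in `[0, ∞]`. -/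
def expectedCount {Ω : Type*} [MeasurableSpace Ω] (P : Measure Ω) (Y : ℕ → Ω → ℝ) (x : ℝ) :
    ℝ≥0∞ :=
  ∫⁻ ω, (firstPassageCount Y x ω : ℝ≥0∞) ∂P

/-- The law of `X` is arithmetic: for some `d > 0`, `X` is almost surely an integer multiple
of `d`. -/
def IsArithmetic {Ω : Type*} [MeasurableSpace Ω] (P : Measure Ω) (X : Ω → ℝ) : Prop :=
  ∃ d : ℝ, 0 < d ∧ ∀ᵐ ω ∂P, ∃ k : ℤ, X ω = k * d

end

/-! Since partial sums of nonnegative hops are nondecreasing, `M(x)` counts the `n ≥ 0` with `Y₁ + ⋯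
+ Yₙ ≤ x`, so `N` is the renewal function `U = ∑ F^{*n}(-∞, x]` of the hop law `F`. Put `μ = ∫ y dF`
and `D(x) = U(x) - x⁺/μ`.

Two identities drive the proof. The renewal equation `U = 1_{[0,∞)} + F * U` makes `D`
asymptotically harmonic: `D - F * D → 0`. Integrated, it says that `U` convolved with the tail
density `F(t, ∞)` is `x⁺`. Hence the tail average of `D` is `∫ min(x, t) F(t, ∞) dt / μ`, which
tends to `E[Y²] / (2μ)`. The tail measure has mass `μ`, so the claimed limit of `D` is this value
divided by `μ`.

Passing from the average to `D` itself is Tauberian (`tendsto_of_tendsto_smear`). A window average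
`G` of `D` is bounded, uniformly continuous and asymptotically harmonic. An energy argument sends
the mean square increment of `G` under `F` to zero, so every point of the support of `F` is an
asymptotic period of `G`. These periods form a closed subgroup, which is all of `ℝ` when `F` is
non-arithmetic (`tendsto_translate_sub`). Thus `G` is asymptotically equal to its own tail average
and converges. Finally `D(x) + x/μ` is nondecreasing on `[0, ∞)`, so the window can be removed. -/

/-! ### Bounded measurable functions and their convolution with finite measures. -/

/-- A bounded measurable real function. -/
structure IsBoundedMeasurable (f : ℝ → ℝ) : Prop where
  measurable : Measurable f
  bounded : ∃ C, ∀ x, |f x| ≤ C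

namespace IsBoundedMeasurable

variable {f g : ℝ → ℝ}

lemma add (hf : IsBoundedMeasurable f) (hg : IsBoundedMeasurable g) :
    IsBoundedMeasurable fun x => f x + g x := by
  obtain ⟨C, hC⟩ := hf.bounded
  obtain ⟨K, hK⟩ := hg.bounded
  exact ⟨hf.measurable.add hg.measurable, C + K,
    fun x => (abs_add_le _ _).trans (add_le_add (hC x) (hK x))⟩

lemma mul (hf : IsBoundedMeasurable f) (hg : IsBoundedMeasurable g) :
    IsBoundedMeasurable fun x => f x * g x := by
  obtain ⟨C, hC⟩ := hf.bounded
  obtain ⟨K, hK⟩ := hg.bounded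
  refine ⟨hf.measurable.mul hg.measurable, C * K, fun x => ?_⟩
  rw [abs_mul]
  exact mul_le_mul (hC x) (hK x) (abs_nonneg _) ((abs_nonneg _).trans (hC x))

lemma const (c : ℝ) : IsBoundedMeasurable fun _ => c :=
  ⟨measurable_const, |c|, fun _ => le_rfl⟩

lemma const_mul (hf : IsBoundedMeasurable f) (c : ℝ) : IsBoundedMeasurable fun x => c * f x :=
  (const c).mul hf

lemma sub (hf : IsBoundedMeasurable f) (hg : IsBoundedMeasurable g) :
    IsBoundedMeasurable fun x => f x - g x := by
  simpa [sub_eq_add_neg] using hf.add (hg.const_mul (-1))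

lemma abs (hf : IsBoundedMeasurable f) : IsBoundedMeasurable fun x => |f x| := by
  obtain ⟨C, hC⟩ := hf.bounded
  exact ⟨hf.measurable.abs, C, fun x => by simpa using hC x⟩

lemma comp_const_sub (hf : IsBoundedMeasurable f) (x : ℝ) :
    IsBoundedMeasurable fun t => f (x - t) := by
  obtain ⟨C, hC⟩ := hf.bounded
  exact ⟨hf.measurable.comp (measurable_const.sub measurable_id), C, fun t => hC _⟩

lemma comp_sub_const (hf : IsBoundedMeasurable f) (a : ℝ) :
    IsBoundedMeasurable fun t => f (t - a) := by
  obtain ⟨C, hC⟩ := hf.bounded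
  exact ⟨hf.measurable.comp (measurable_id.sub measurable_const), C, fun t => hC _⟩

lemma integrable (hf : IsBoundedMeasurable f) (m : Measure ℝ) [IsFiniteMeasure m] :
    Integrable f m := by
  obtain ⟨C, hC⟩ := hf.bounded
  exact Integrable.of_bound hf.measurable.aestronglyMeasurable C (ae_of_all _ hC)

end IsBoundedMeasurable

/-- The convolution `x ↦ ∫ f (x - t) dm(t)` of a function with a measure. -/
noncomputable def smear (m : Measure ℝ) (f : ℝ → ℝ) (x : ℝ) : ℝ := ∫ t, f (x - t) ∂m

section smear

variable {f g : ℝ → ℝ} (m : Measure ℝ) [IsFiniteMeasure m]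

lemma IsBoundedMeasurable.smear (hf : IsBoundedMeasurable f) :
    IsBoundedMeasurable (smear m f) := by
  obtain ⟨C, hC⟩ := hf.bounded
  refine ⟨?_, C * m.real Set.univ, fun x => ?_⟩
  · have : StronglyMeasurable (Function.uncurry fun x t : ℝ => f (x - t)) :=
      (hf.measurable.comp (measurable_fst.sub measurable_snd)).stronglyMeasurable
    exact (this.integral_prod_right (ν := m)).measurable
  · exact norm_integral_le_of_norm_le_const (f := fun t => f (x - t)) (ae_of_all _ fun t => hC _)

lemma smear_mono (hf : IsBoundedMeasurable f) (hg : IsBoundedMeasurable g)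
    (h : ∀ x, f x ≤ g x) (x : ℝ) : smear m f x ≤ smear m g x :=
  integral_mono ((hf.comp_const_sub x).integrable m) ((hg.comp_const_sub x).integrable m)
    fun _ => h _

lemma smear_add (hf : IsBoundedMeasurable f) (hg : IsBoundedMeasurable g) (x : ℝ) :
    smear m (fun y => f y + g y) x = smear m f x + smear m g x :=
  integral_add ((hf.comp_const_sub x).integrable m) ((hg.comp_const_sub x).integrable m)

lemma smear_sub (hf : IsBoundedMeasurable f) (hg : IsBoundedMeasurable g) (x : ℝ) :
    smear m (fun y => f y - g y) x = smear m f x - smear m g x :=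
  integral_sub ((hf.comp_const_sub x).integrable m) ((hg.comp_const_sub x).integrable m)

omit [IsFiniteMeasure m] in
lemma smear_const_mul (c : ℝ) (x : ℝ) :
    smear m (fun y => c * f y) x = c * smear m f x :=
  integral_const_mul _ _

lemma smear_comm (hf : IsBoundedMeasurable f) (m' : Measure ℝ) [IsFiniteMeasure m'] (x : ℝ) :
    smear m (smear m' f) x = smear m' (smear m f) x := by
  unfold smear
  rw [integral_integral_swap]
  · simp_rw [sub_right_comm]
  · obtain ⟨C, hC⟩ := hf.bounded
    refine Integrable.of_bound (Measurable.aestronglyMeasurable ?_) C (ae_of_all _ fun p => hC _)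
    exact hf.measurable.comp ((measurable_const.sub measurable_fst).sub measurable_snd)

lemma tendsto_smear (hf : IsBoundedMeasurable f) {L : ℝ} (h : Tendsto f atTop (𝓝 L)) :
    Tendsto (smear m f) atTop (𝓝 (L * m.real Set.univ)) := by
  obtain ⟨C, hC⟩ := hf.bounded
  have := tendsto_integral_filter_of_dominated_convergence (μ := m) (l := atTop)
    (F := fun x t => f (x - t)) (f := fun _ => L) (fun _ => C)
    (.of_forall fun x => (hf.comp_const_sub x).measurable.aestronglyMeasurable)
    (.of_forall fun x => ae_of_all _ fun t => hC _) (integrable_const _)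
    (ae_of_all _ fun t => h.comp (tendsto_atTop_add_const_right _ (-t) tendsto_id))
  rw [integral_const, smul_eq_mul, mul_comm] at this
  exact this

lemma tendsto_smear_zero (hf : IsBoundedMeasurable f) (h : Tendsto f atTop (𝓝 0)) :
    Tendsto (smear m f) atTop (𝓝 0) := by
  simpa using tendsto_smear m hf h

end smear

/-! ### Asymptotically harmonic functions and their periods at infinity. -/

section asymptoticPeriods

variable (F : Measure ℝ) {G : ℝ → ℝ}

/-- The mean square increment `∫ (G (x - y) - G x) ^ 2 dF(y)`. -/
noncomputable def meanSqIncrement (F : Measure ℝ) (G : ℝ → ℝ) (x : ℝ) : ℝ :=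
  ∫ y, (G (x - y) - G x) ^ 2 ∂F

variable [IsProbabilityMeasure F]

/-- Expanding the square isolates `F * G² - G²`, which telescopes under iteration; the rest is
controlled by the defect `G - F * G`. -/
lemma meanSqIncrement_eq (hG : IsBoundedMeasurable G) (x : ℝ) :
    meanSqIncrement F G x =
      smear F (fun y => G y * G y) x - G x * G x + 2 * (G x * (G x - smear F G x)) := by
  have h1 := ((hG.mul hG).comp_const_sub x).integrable F
  have h2 := ((hG.comp_const_sub x).const_mul (2 * G x)).integrable F
  have : meanSqIncrement F G x =
      ∫ y, (G (x - y) * G (x - y) - 2 * G x * G (x - y) + G x * G x) ∂F :=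
    integral_congr_ae (ae_of_all _ fun y => by ring)
  have h3 : Integrable (fun y => G (x - y) * G (x - y) - 2 * G x * G (x - y)) F := h1.sub h2
  rw [this, integral_add h3 (integrable_const _), integral_sub h1 h2, integral_const_mul]
  simp only [smear, integral_const, probReal_univ, one_smul]
  ring

lemma IsBoundedMeasurable.meanSqIncrement (hG : IsBoundedMeasurable G) :
    IsBoundedMeasurable (meanSqIncrement F G) := by
  rw [funext (meanSqIncrement_eq F hG)]
  exact (((hG.mul hG).smear F).sub (hG.mul hG)).add
    ((hG.mul (hG.sub (hG.smear F))).const_mul 2)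

lemma sq_integral_le {f : ℝ → ℝ} (hf : IsBoundedMeasurable f) :
    (∫ w, f w ∂F) ^ 2 ≤ ∫ w, f w ^ 2 ∂F := by
  set a := ∫ w, f w ∂F with ha
  have h1 := hf.integrable F
  have h2 : Integrable (fun w => f w ^ 2) F := by simpa [sq] using (hf.mul hf).integrable F
  have h0 : 0 ≤ ∫ w, (f w - a) ^ 2 ∂F := integral_nonneg fun _ => sq_nonneg _
  have : ∫ w, (f w - a) ^ 2 ∂F = ∫ w, (f w ^ 2 - 2 * a * f w + a ^ 2) ∂F :=
    integral_congr_ae (ae_of_all _ fun y => by ring)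
  have h3 : Integrable (fun w => f w ^ 2 - 2 * a * f w) F := h2.sub (h1.const_mul _)
  rw [this, integral_add h3 (integrable_const _),
    integral_sub h2 (h1.const_mul _), integral_const_mul] at h0
  simp only [← ha, integral_const, probReal_univ, one_smul] at h0
  nlinarith

/-- Up to the defects at `x - y` and `x`, the increment `G (x - y) - G x` is the `F`-average over
`w` of the same increment based at `x - w`. Jensen's inequality and Fubini then show that the mean
square increment is almost subharmonic. -/
lemma meanSqIncrement_le_smear (hG : IsBoundedMeasurable G)
    (hlim : Tendsto (fun x => G x - smear F G x) atTop (𝓝 0)) :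
    ∃ s : ℝ → ℝ, IsBoundedMeasurable s ∧ Tendsto s atTop (𝓝 0) ∧
      ∀ x, meanSqIncrement F G x ≤ smear F (meanSqIncrement F G) x + s x := by
  have hGF := hG.smear F
  have he := hG.sub hGF
  set e := fun x => G x - smear F G x with he_def
  obtain ⟨C, hC⟩ := hG.bounded
  obtain ⟨K, hK⟩ := hGF.bounded
  have hC0 : 0 ≤ C := (abs_nonneg _).trans (hC 0)
  have hK0 : 0 ≤ K := (abs_nonneg _).trans (hK 0)
  -- `B` bounds `|d + a|` in the factorisation `d² - a² = (d + a)(d - a)` used below.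
  set B := 2 * C + 2 * K
  have hsF := he.abs.smear F
  refine ⟨fun x => B * (smear F (fun y => |e y|) x + |e x|),
    (hsF.add he.abs).const_mul B, ?_, fun x => ?_⟩
  · have h1 : Tendsto (fun x => |e x|) atTop (𝓝 0) := by simpa using hlim.abs
    simpa using ((tendsto_smear_zero F he.abs h1).add h1).const_mul B
  have hinc : ∀ y, IsBoundedMeasurable fun w => G (x - w - y) - G (x - w) := fun y =>
    ((hG.comp_sub_const y).sub hG).comp_const_sub x
  have hpt : ∀ y, (G (x - y) - G x) ^ 2 ≤
      (∫ w, (G (x - w - y) - G (x - w)) ^ 2 ∂F) + B * (|e (x - y)| + |e x|) := by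
    intro y
    have hj := sq_integral_le F (hinc y)
    have ha : ∫ w, (G (x - w - y) - G (x - w)) ∂F = smear F G (x - y) - smear F G x := by
      rw [integral_sub (((hG.comp_sub_const y).comp_const_sub x).integrable F)
        ((hG.comp_const_sub x).integrable F)]
      simp only [smear, sub_right_comm]
    rw [ha] at hj
    set a := smear F G (x - y) - smear F G x with ha'
    set d := G (x - y) - G x with hd
    have hde : d - a = e (x - y) - e x := by simp only [hd, ha', he_def]; ring
    have h1 : |d - a| ≤ |e (x - y)| + |e x| := by rw [hde]; exact abs_sub _ _
    have h2 : |d + a| ≤ B := by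
      have := abs_le.1 (hC (x - y)); have := abs_le.1 (hC x)
      have := abs_le.1 (hK (x - y)); have := abs_le.1 (hK x)
      rw [abs_le]; constructor <;> simp only [hd, ha', B] <;> linarith
    have h3 : d ^ 2 - a ^ 2 ≤ |d + a| * |d - a| := by
      rw [← abs_mul]; exact (le_of_eq (by ring)).trans (le_abs_self _)
    have h4 : |d + a| * |d - a| ≤ B * (|e (x - y)| + |e x|) :=
      mul_le_mul h2 h1 (abs_nonneg _) (by positivity)
    linarith
  have hprod : Integrable (Function.uncurry fun y w => (G (x - w - y) - G (x - w)) ^ 2)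
      (F.prod F) := by
    refine Integrable.of_bound (Measurable.aestronglyMeasurable ?_) ((2 * C) ^ 2)
      (ae_of_all _ fun p => ?_)
    · have hm := hG.measurable
      exact ((hm.comp ((measurable_const.sub measurable_snd).sub measurable_fst)).sub
        (hm.comp (measurable_const.sub measurable_snd))).pow_const 2
    · simp only [Function.uncurry, Real.norm_eq_abs, abs_pow]
      have := abs_le.1 (hC (x - p.2 - p.1)); have := abs_le.1 (hC (x - p.2))
      exact pow_le_pow_left₀ (abs_nonneg _) (abs_le.2 ⟨by linarith, by linarith⟩) 2
  have hI1 : Integrable (fun y => ∫ w, (G (x - w - y) - G (x - w)) ^ 2 ∂F) F :=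
    hprod.integral_prod_left
  have hI2 : Integrable (fun y => B * (|e (x - y)| + |e x|)) F :=
    (((he.abs.comp_const_sub x).add (.const _)).const_mul B).integrable F
  have hI0 : Integrable (fun y => (G (x - y) - G x) ^ 2) F := by
    have := (hG.comp_const_sub x).sub (.const (G x))
    simpa [sq] using (this.mul this).integrable F
  have hmono := integral_mono hI0 (hI1.add hI2) hpt
  have hsum : ∫ y, ((∫ w, (G (x - w - y) - G (x - w)) ^ 2 ∂F) + B * (|e (x - y)| + |e x|)) ∂F =
      smear F (meanSqIncrement F G) x + B * (smear F (fun y => |e y|) x + |e x|) := by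
    rw [integral_add hI1 hI2, integral_integral_swap hprod, integral_const_mul,
      integral_add ((he.abs.comp_const_sub x).integrable F) (integrable_const _)]
    simp [smear, meanSqIncrement]
  exact hmono.trans_eq hsum

/-- Here `w` is the `n`-fold smearing of `G²`. Smearing the bound for `n` and adding
`meanSqIncrement_eq` cancels `F * G²`, so the main term stays below `C` while the left side grows
with `n`. -/
lemma nsmul_meanSqIncrement_le (hG : IsBoundedMeasurable G) {C : ℝ} (hC : ∀ x, G x * G x ≤ C)
    (hlim : Tendsto (fun x => G x - smear F G x) atTop (𝓝 0)) (n : ℕ) :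
    ∃ w s : ℝ → ℝ, IsBoundedMeasurable w ∧ (∀ x, w x ≤ C) ∧ IsBoundedMeasurable s ∧
      Tendsto s atTop (𝓝 0) ∧ ∀ x, n * meanSqIncrement F G x ≤ w x - G x * G x + s x := by
  obtain ⟨s₁, hs₁, hs₁', hv⟩ := meanSqIncrement_le_smear F hG hlim
  have hV := hG.meanSqIncrement F
  have he := hG.sub (hG.smear F)
  induction n with
  | zero => exact ⟨fun x => G x * G x, fun _ => 0, hG.mul hG, hC, .const 0, tendsto_const_nhds,
      fun x => by simp⟩
  | succ n ih =>
    obtain ⟨w, s, hw, hwC, hs, hs', hle⟩ := ih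
    refine ⟨smear F w, fun x => smear F s x + n * s₁ x + 2 * (G x * (G x - smear F G x)),
      hw.smear F, fun x => ?_, ((hs.smear F).add (hs₁.const_mul n)).add
        ((hG.mul he).const_mul 2), ?_, fun x => ?_⟩
    · refine (smear_mono F hw (.const C) hwC x).trans_eq ?_
      simp [smear]
    · have h2 : Tendsto (fun x => G x * (G x - smear F G x)) atTop (𝓝 0) := by
        obtain ⟨K, hK⟩ := hG.bounded
        refine squeeze_zero_norm (a := fun x => K * |G x - smear F G x|) (fun x => ?_)
          (by simpa using hlim.abs.const_mul K)
        rw [norm_mul]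
        exact mul_le_mul_of_nonneg_right (hK x) (norm_nonneg _)
      simpa using ((tendsto_smear_zero F hs hs').add (hs₁'.const_mul (n : ℝ))).add
        (h2.const_mul 2)
    · have h1 := smear_mono F (hV.const_mul n) ((hw.sub (hG.mul hG)).add hs) hle x
      rw [smear_const_mul, smear_add F (hw.sub (hG.mul hG)) hs,
        smear_sub F hw (hG.mul hG)] at h1
      have h2 := mul_le_mul_of_nonneg_left (hv x) (Nat.cast_nonneg (α := ℝ) n)
      have h3 := meanSqIncrement_eq F hG x
      push_cast
      linarith

lemma tendsto_meanSqIncrement (hG : IsBoundedMeasurable G)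
    (hlim : Tendsto (fun x => G x - smear F G x) atTop (𝓝 0)) :
    Tendsto (meanSqIncrement F G) atTop (𝓝 0) := by
  obtain ⟨C, hC⟩ := (hG.mul hG).bounded
  have hC0 : 0 ≤ C := (abs_nonneg _).trans (hC 0)
  rw [Metric.tendsto_atTop]
  intro ε hε
  -- Eventually `s < 1`, so `n` times the mean square increment is below `C + 1 < n * ε`.
  obtain ⟨n, hn⟩ := exists_nat_gt ((C + 1) / ε)
  have hn0 : (0 : ℝ) < n := lt_of_le_of_lt (by positivity) hn
  obtain ⟨w, s, -, hwC, -, hs', hle⟩ := nsmul_meanSqIncrement_le F hG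
    (fun x => (le_abs_self _).trans (hC x)) hlim n
  obtain ⟨x₀, hx₀⟩ := eventually_atTop.1 (hs'.eventually_lt_const one_pos)
  refine ⟨x₀, fun x hx => ?_⟩
  have hv0 : 0 ≤ meanSqIncrement F G x := integral_nonneg fun _ => sq_nonneg _
  rw [Real.dist_eq, sub_zero, abs_of_nonneg hv0]
  rw [div_lt_iff₀ hε] at hn
  have h := hle x
  have h1 := hx₀ x hx
  have h2 := hwC x
  have h3 := mul_self_nonneg (G x)
  by_contra! hcon
  have := mul_le_mul_of_nonneg_left hcon hn0.le
  linarith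

/-- The asymptotic periods of a function at `+∞`. -/
def asymptoticPeriods (G : ℝ → ℝ) : AddSubgroup ℝ where
  carrier := {a | Tendsto (fun x => G (x - a) - G x) atTop (𝓝 0)}
  zero_mem' := by simp
  add_mem' := by
    intro a b ha hb
    have h := (ha.comp (tendsto_atTop_add_const_right _ (-b) tendsto_id)).add hb
    simp only [Set.mem_ofPred_eq, add_zero] at h ⊢
    refine h.congr fun x => ?_
    simp only [Function.comp, id]
    rw [show x + -b - a = x - (a + b) by ring, show x + -b = x - b by ring]
    ring
  neg_mem' := by
    intro a ha
    have h := (ha.comp (tendsto_atTop_add_const_right _ a tendsto_id)).neg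
    simp only [Set.mem_ofPred_eq, neg_zero] at h ⊢
    refine h.congr fun x => ?_
    simp [Function.comp]

lemma isClosed_asymptoticPeriods (hG : UniformContinuous G) :
    IsClosed (asymptoticPeriods G : Set ℝ) := by
  refine isClosed_of_closure_subset fun a ha => ?_
  change Tendsto (fun x => G (x - a) - G x) atTop (𝓝 0)
  rw [Metric.tendsto_atTop]
  intro ε hε
  obtain ⟨δ, hδ, hu⟩ := Metric.uniformContinuous_iff.1 hG (ε / 2) (half_pos hε)
  obtain ⟨b, hb, hab⟩ := Metric.mem_closure_iff.1 ha δ hδ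
  obtain ⟨x₀, hx₀⟩ := Metric.tendsto_atTop.1
    (show Tendsto (fun x => G (x - b) - G x) atTop (𝓝 0) from hb) (ε / 2) (half_pos hε)
  refine ⟨x₀, fun x hx => ?_⟩
  have h1 := hx₀ x hx
  have h2 : dist (G (x - a)) (G (x - b)) < ε / 2 := hu (by rwa [dist_sub_left])
  rw [Real.dist_eq] at h1 h2 ⊢
  rw [abs_lt] at *
  constructor <;> linarith

/-- If `|G (x - a) - G x| ≥ ε`, uniform continuity keeps the increment at least `ε / 2` for all `y`
in a ball around `a`. This ball has positive mass, so the mean square increment could not be small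
at such `x`. -/
lemma support_subset_asymptoticPeriods (hG : IsBoundedMeasurable G) (hu : UniformContinuous G)
    (hlim : Tendsto (fun x => G x - smear F G x) atTop (𝓝 0)) :
    F.support ⊆ asymptoticPeriods G := by
  intro a ha
  change Tendsto (fun x => G (x - a) - G x) atTop (𝓝 0)
  rw [Metric.tendsto_atTop]
  intro ε hε
  obtain ⟨δ, hδ, hu⟩ := Metric.uniformContinuous_iff.1 hu (ε / 2) (half_pos hε)
  have hq : 0 < F.real (Metric.ball a δ) :=
    ENNReal.toReal_pos ((Measure.mem_support_iff_forall _).1 ha _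
      (Metric.ball_mem_nhds a hδ)).ne' (measure_ne_top _ _)
  obtain ⟨x₀, hx₀⟩ := eventually_atTop.1 ((tendsto_meanSqIncrement F hG hlim).eventually_lt_const
    (show 0 < F.real (Metric.ball a δ) * (ε / 2) ^ 2 by positivity))
  refine ⟨x₀, fun x hx => ?_⟩
  have hlt := hx₀ x hx
  by_contra! hcon
  rw [Real.dist_eq, sub_zero] at hcon
  refine hlt.not_ge ?_
  have hI0 : Integrable (fun y => (G (x - y) - G x) ^ 2) F := by
    have := (hG.comp_const_sub x).sub (.const (G x))
    simpa [sq] using (this.mul this).integrable F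
  calc F.real (Metric.ball a δ) * (ε / 2) ^ 2
      = ∫ y in Metric.ball a δ, (ε / 2) ^ 2 ∂F := by simp
    _ ≤ ∫ y in Metric.ball a δ, (G (x - y) - G x) ^ 2 ∂F := by
        refine setIntegral_mono_on (integrable_const _).integrableOn hI0.integrableOn
          measurableSet_ball fun y hy => ?_
        have h2 : dist (G (x - y)) (G (x - a)) < ε / 2 := hu (by rwa [dist_sub_left])
        rw [Real.dist_eq] at h2
        rw [← sq_abs (G (x - y) - G x)]
        refine pow_le_pow_left₀ (by positivity) ?_ 2
        have h3 := abs_sub_abs_le_abs_sub (G (x - a) - G x) (G (x - y) - G x)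
        rw [show G (x - a) - G x - (G (x - y) - G x) = -(G (x - y) - G (x - a)) by ring,
          abs_neg] at h3
        linarith
    _ ≤ ∫ y, (G (x - y) - G x) ^ 2 ∂F :=
        setIntegral_le_integral hI0 (ae_of_all _ fun _ => sq_nonneg _)

/-- A bounded uniformly continuous function that is asymptotically harmonic for a non-arithmetic
law is asymptotically constant along translations. -/
theorem tendsto_translate_sub (hF : ∀ d : ℝ, 0 < d → ¬ ∀ᵐ y ∂F, ∃ k : ℤ, y = k * d)
    (hG : IsBoundedMeasurable G) (hu : UniformContinuous G)
    (hlim : Tendsto (fun x => G x - smear F G x) atTop (𝓝 0)) (a : ℝ) :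
    Tendsto (fun x => G (x - a) - G x) atTop (𝓝 0) := by
  suffices asymptoticPeriods G = ⊤ by
    have h : a ∈ asymptoticPeriods G := this ▸ AddSubgroup.mem_top a
    exact h
  have hae : ∀ᵐ y ∂F, y ∈ asymptoticPeriods G := by
    filter_upwards [F.support_mem_ae] with y hy
    exact support_subset_asymptoticPeriods F hG hu hlim hy
  rcases AddSubgroup.dense_or_cyclic (asymptoticPeriods G) with h | ⟨b, hb⟩
  · rw [← SetLike.coe_set_eq, ← (isClosed_asymptoticPeriods hu).closure_eq, h.closure_eq]
    rfl
  · exfalso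
    rw [hb] at hae
    -- The trivial subgroup would make `F` the point mass at `0`, which is arithmetic for any span;
    -- `1` is chosen.
    rcases eq_or_ne b 0 with rfl | hb0
    · refine hF 1 one_pos (hae.mono fun y hy => ⟨0, ?_⟩)
      simpa [AddSubgroup.mem_closure_singleton, eq_comm] using hy
    · refine hF |b| (abs_pos.2 hb0) (hae.mono fun y hy => ?_)
      obtain ⟨k, rfl⟩ := AddSubgroup.mem_closure_singleton.1 hy
      rcases abs_choice b with h | h
      · exact ⟨k, by simp [h]⟩
      · exact ⟨-k, by simp [h]⟩

end asymptoticPeriods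

/-! ### Tauberian step: from a convergent average to convergence. -/

section tauberian

variable {D : ℝ → ℝ}

/-- The integral of a bounded function over a sliding window is Lipschitz, whether or not `D` is
continuous. -/
lemma uniformContinuous_smear_volume (hD : IsBoundedMeasurable D) {h : ℝ} (hh : 0 ≤ h) :
    UniformContinuous (smear (volume.restrict (Set.Ioc 0 h)) D) := by
  obtain ⟨C, hC⟩ := hD.bounded
  have hC0 : 0 ≤ C := (abs_nonneg _).trans (hC 0)
  have hI : ∀ a b, IntervalIntegrable D volume a b := fun a b =>
    ⟨hD.integrable _, hD.integrable _⟩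
  have key : ∀ x, smear (volume.restrict (Set.Ioc 0 h)) D x = ∫ u in (x - h)..x, D u := fun x => by
    rw [smear, ← intervalIntegral.integral_of_le hh, intervalIntegral.integral_comp_sub_left,
      sub_zero]
  refine LipschitzWith.uniformContinuous (K := (2 * C).toNNReal)
    (LipschitzWith.of_dist_le_mul fun x y => ?_)
  rw [Real.coe_toNNReal _ (by positivity), Real.dist_eq, Real.dist_eq, key, key,
    intervalIntegral.integral_interval_sub_interval_comm (hI _ _) (hI _ _) (hI _ _)]
  have h1 := intervalIntegral.norm_integral_le_of_norm_le_const (f := D) (C := C)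
    (a := x - h) (b := y - h) fun u _ => hC u
  have h2 := intervalIntegral.norm_integral_le_of_norm_le_const (f := D) (C := C)
    (a := x) (b := y) fun u _ => hC u
  rw [sub_sub_sub_cancel_right, abs_sub_comm] at h1
  rw [abs_sub_comm y x] at h2
  refine (abs_sub _ _).trans ?_
  rw [Real.norm_eq_abs] at h1 h2
  linarith

/-- Convolutions commute, so the window average `G` inherits asymptotic harmonicity and `m * G → L *
h`. Since the increments of `G` vanish at infinity, `m * G` differs from `m(ℝ) G` by `o(1)`. -/
lemma tendsto_smear_volume (F : Measure ℝ) [IsProbabilityMeasure F]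
    (hF : ∀ d : ℝ, 0 < d → ¬ ∀ᵐ y ∂F, ∃ k : ℤ, y = k * d)
    (m : Measure ℝ) [IsFiniteMeasure m] (hm : 0 < m.real Set.univ)
    (hD : IsBoundedMeasurable D) {L h : ℝ} (hh : 0 ≤ h)
    (hlim : Tendsto (fun x => D x - smear F D x) atTop (𝓝 0))
    (hL : Tendsto (smear m D) atTop (𝓝 L)) :
    Tendsto (smear (volume.restrict (Set.Ioc 0 h)) D) atTop
      (𝓝 (h * (L / m.real Set.univ))) := by
  set l := volume.restrict (Set.Ioc 0 h) with hl
  set G := smear l D with hGdef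
  have hG : IsBoundedMeasurable G := hD.smear l
  have hl1 : l.real Set.univ = h := by simp [hl, measureReal_def, hh]
  have hGlim : Tendsto (fun x => G x - smear F G x) atTop (𝓝 0) := by
    refine (tendsto_smear_zero l (hD.sub (hD.smear F)) hlim).congr fun x => ?_
    rw [smear_sub l hD (hD.smear F), smear_comm l hD F]
  have hGm : Tendsto (smear m G) atTop (𝓝 (L * h)) := by
    rw [← hl1]
    exact (tendsto_smear l (hD.smear m) hL).congr fun x => smear_comm l hD m x
  have htr := tendsto_translate_sub F hF hG (uniformContinuous_smear_volume hD hh) hGlim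
  obtain ⟨C, hC⟩ := hG.bounded
  have hdct := tendsto_integral_filter_of_dominated_convergence (μ := m) (l := atTop)
    (F := fun x t => G (x - t) - G x) (f := fun _ => 0) (fun _ => C + C)
    (.of_forall fun x => ((hG.comp_const_sub x).sub (.const _)).measurable.aestronglyMeasurable)
    (.of_forall fun x => ae_of_all _ fun t => (abs_sub _ _).trans (add_le_add (hC _) (hC _)))
    (integrable_const _) (ae_of_all _ fun t => htr t)
  have hfin := (hGm.sub hdct).div_const (m.real Set.univ)
  simp only [integral_zero, sub_zero] at hfin
  rw [show h * (L / m.real Set.univ) = L * h / m.real Set.univ by ring]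
  refine hfin.congr fun x => ?_
  rw [integral_sub ((hG.comp_const_sub x).integrable m) (integrable_const _)]
  simp only [smear, integral_const, smul_eq_mul, sub_sub_cancel]
  field_simp

lemma smear_volume_le (hD : IsBoundedMeasurable D) {h K : ℝ} (hh : 0 ≤ h) (hK : 0 ≤ K)
    (hmono : MonotoneOn (fun x => D x + K * x) (Set.Ici 0)) {x : ℝ} (hx : h ≤ x) :
    smear (volume.restrict (Set.Ioc 0 h)) D x ≤ h * (D x + K * h) := by
  calc smear (volume.restrict (Set.Ioc 0 h)) D x
      ≤ ∫ t in Set.Ioc 0 h, (D x + K * h) := by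
        refine setIntegral_mono_on ((hD.comp_const_sub x).integrable _) (integrable_const _)
          measurableSet_Ioc fun t ht => ?_
        have := hmono (a := x - t) (b := x) (by simp; linarith [ht.2]) (by simp; linarith)
          (by linarith [ht.1])
        simp only at this
        nlinarith [ht.1, ht.2]
    _ = h * (D x + K * h) := by simp [hh]

/-- Monotonicity only limits how fast `D` falls, so the lower bound on the average uses the window
to the right of `x`, hence the evaluation at `x + h`. -/
lemma le_smear_volume (hD : IsBoundedMeasurable D) {h K : ℝ} (hh : 0 ≤ h) (hK : 0 ≤ K)
    (hmono : MonotoneOn (fun x => D x + K * x) (Set.Ici 0)) {x : ℝ} (hx : 0 ≤ x) :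
    h * (D x - K * h) ≤ smear (volume.restrict (Set.Ioc 0 h)) D (x + h) := by
  calc h * (D x - K * h) = ∫ t in Set.Ioc 0 h, (D x - K * h) := by simp [hh]
    _ ≤ smear (volume.restrict (Set.Ioc 0 h)) D (x + h) := by
        refine setIntegral_mono_on (integrable_const _) ((hD.comp_const_sub _).integrable _)
          measurableSet_Ioc fun t ht => ?_
        have := hmono (a := x) (b := x + h - t) hx (by simp; linarith [ht.2])
          (by linarith [ht.2])
        simp only at this
        nlinarith [ht.1, ht.2]

/-- A bounded, slowly decreasing, asymptotically harmonic function for a non-arithmetic law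
converges as soon as one of its averages does. -/
theorem tendsto_of_tendsto_smear (F : Measure ℝ) [IsProbabilityMeasure F]
    (hF : ∀ d : ℝ, 0 < d → ¬ ∀ᵐ y ∂F, ∃ k : ℤ, y = k * d)
    (m : Measure ℝ) [IsFiniteMeasure m] (hm : 0 < m.real Set.univ)
    (hD : IsBoundedMeasurable D) {L K : ℝ} (hK : 0 < K)
    (hlim : Tendsto (fun x => D x - smear F D x) atTop (𝓝 0))
    (hL : Tendsto (smear m D) atTop (𝓝 L))
    (hmono : MonotoneOn (fun x => D x + K * x) (Set.Ici 0)) :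
    Tendsto D atTop (𝓝 (L / m.real Set.univ)) := by
  set c := L / m.real Set.univ
  rw [Metric.tendsto_atTop]
  intro ε hε
  -- Over a window of this length `D` drops by at most `K * h = ε / 2`; the other `ε / 2` is the
  -- error in the window average.
  set h := ε / (2 * K) with hh_def
  have hh : 0 < h := by positivity
  have hKh : K * h = ε / 2 := by rw [hh_def]; field_simp
  have hG := tendsto_smear_volume F hF m hm hD hh.le hlim hL
  obtain ⟨x₀, hx₀⟩ := Metric.tendsto_atTop.1 hG (h * (ε / 2)) (by positivity)
  refine ⟨max x₀ h, fun x hx => ?_⟩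
  have hx1 := (le_max_left _ _).trans hx
  have hx2 := (le_max_right _ _).trans hx
  have h1 := hx₀ x hx1
  have h2 := hx₀ (x + h) (by linarith)
  have h3 := smear_volume_le hD hh.le hK.le hmono hx2
  have h4 := le_smear_volume hD hh.le hK.le hmono (hh.le.trans hx2)
  rw [Real.dist_eq, abs_lt] at h1 h2 ⊢
  rw [hKh] at h3 h4
  constructor
  · have : h * (c - ε / 2) < h * (D x + ε / 2) := by linarith [h1.1]
    linarith [lt_of_mul_lt_mul_left this hh.le]
  · have : h * (D x - ε / 2) < h * (c + ε / 2) := by linarith [h2.2]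
    linarith [lt_of_mul_lt_mul_left this hh.le]

end tauberian

/-! ### The renewal function: finiteness and the renewal equations. -/

section renewal

/-- The `n`-fold convolution power of a measure on `ℝ`. -/
noncomputable def convPow (F : Measure ℝ) : ℕ → Measure ℝ
  | 0 => Measure.dirac 0
  | n + 1 => F.conv (convPow F n)

/-- The renewal function `x ↦ ∑ₙ F^{*n} (-∞, x]`. -/
noncomputable def renewalFunction (F : Measure ℝ) (x : ℝ) : ℝ≥0∞ :=
  ∑' n, convPow F n (Set.Iic x)

variable (F : Measure ℝ) [IsProbabilityMeasure F]

instance isProbabilityMeasure_convPow (n : ℕ) : IsProbabilityMeasure (convPow F n) := by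
  induction n with
  | zero => exact Measure.dirac.isProbabilityMeasure
  | succ n ih => exact inferInstanceAs (IsProbabilityMeasure (F.conv (convPow F n)))

lemma convPow_succ_Iic (n : ℕ) (x : ℝ) :
    convPow F (n + 1) (Set.Iic x) = ∫⁻ y, convPow F n (Set.Iic (x - y)) ∂F := by
  rw [convPow, ← lintegral_indicator_one measurableSet_Iic,
    Measure.lintegral_conv (measurable_one.indicator measurableSet_Iic)]
  refine lintegral_congr fun y => ?_
  rw [← lintegral_indicator_one measurableSet_Iic]
  refine lintegral_congr fun z => ?_
  simp only [Set.indicator, Set.mem_Iic, le_sub_iff_add_le', Pi.one_apply]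

omit [IsProbabilityMeasure F] in
lemma convPow_zero_Iic (x : ℝ) :
    convPow F 0 (Set.Iic x) = (Set.Ici (0 : ℝ)).indicator 1 x := by
  simp [convPow, Measure.dirac_apply' _ measurableSet_Iic, Set.indicator]

lemma convPow_Iic_of_neg (hpos : ∀ᵐ y ∂F, 0 ≤ y) (n : ℕ) {x : ℝ} (hx : x < 0) :
    convPow F n (Set.Iic x) = 0 := by
  induction n generalizing x with
  | zero => simp [convPow_zero_Iic, hx]
  | succ n ih =>
    rw [convPow_succ_Iic, lintegral_eq_zero_of_ae_eq_zero]
    filter_upwards [hpos] with y hy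
    exact ih (by linarith)

omit [IsProbabilityMeasure F] in
lemma measurable_convPow_Iic (n : ℕ) : Measurable fun x => convPow F n (Set.Iic x) :=
  Monotone.measurable fun _ _ h => measure_mono (Set.Iic_subset_Iic.2 h)

omit [IsProbabilityMeasure F] in
lemma monotone_renewalFunction : Monotone (renewalFunction F) := fun _ _ h =>
  ENNReal.tsum_le_tsum fun _ => measure_mono (Set.Iic_subset_Iic.2 h)

lemma renewalFunction_of_neg (hpos : ∀ᵐ y ∂F, 0 ≤ y) {x : ℝ} (hx : x < 0) :
    renewalFunction F x = 0 := by
  simp [renewalFunction, convPow_Iic_of_neg F hpos _ hx]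

/-- The renewal equation. -/
lemma renewalFunction_eq (x : ℝ) :
    renewalFunction F x =
      (Set.Ici (0 : ℝ)).indicator 1 x + ∫⁻ y, renewalFunction F (x - y) ∂F := by
  unfold renewalFunction
  rw [tsum_eq_zero_add' ENNReal.summable, convPow_zero_Iic, lintegral_tsum]
  · simp_rw [convPow_succ_Iic]
  · exact fun n => ((measurable_convPow_Iic F n).comp
      (measurable_const.sub measurable_id)).aemeasurable

lemma lintegral_exp_neg_lt_one (hpos : ∀ᵐ y ∂F, 0 ≤ y) (h0 : ¬ ∀ᵐ y ∂F, y = 0) :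
    ∫⁻ y, ENNReal.ofReal (Real.exp (-y)) ∂F < 1 := by
  refine lt_of_le_of_ne ?_ fun h => h0 ?_
  · calc ∫⁻ y, ENNReal.ofReal (Real.exp (-y)) ∂F ≤ ∫⁻ _, 1 ∂F :=
        lintegral_mono_ae (hpos.mono fun y hy => by simpa using hy)
      _ = 1 := by simp
  · have hle : (fun y : ℝ => ENNReal.ofReal (Real.exp (-y))) ≤ᵐ[F] fun _ => 1 :=
      hpos.mono fun y hy => by simpa using hy
    have := ae_eq_of_ae_le_of_lintegral_le hle (by simp [h]) aemeasurable_const (by simp [h])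
    exact this.mono fun y hy => by simpa using hy

/-- Exponential Markov bound: the Laplace transform at `1` is multiplicative under convolution. It
is less than `1` for a nonnegative law other than the point mass at `0`, so the renewal series is
dominated by a geometric one. -/
lemma convPow_Iic_le (n : ℕ) (x : ℝ) :
    convPow F n (Set.Iic x) ≤
      ENNReal.ofReal (Real.exp x) * (∫⁻ y, ENNReal.ofReal (Real.exp (-y)) ∂F) ^ n := by
  induction n generalizing x with
  | zero =>
    rw [convPow_zero_Iic, pow_zero, mul_one]
    refine Set.indicator_le' (g := fun y => ENNReal.ofReal (Real.exp y)) (fun y hy => ?_)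
      (fun _ _ => bot_le) x
    simpa using hy
  | succ n ih =>
    rw [convPow_succ_Iic, pow_succ', ← mul_assoc, ← lintegral_const_mul _ (by fun_prop),
      ← lintegral_mul_const _ (by fun_prop)]
    refine lintegral_mono fun y => (ih (x - y)).trans_eq ?_
    rw [sub_eq_add_neg, Real.exp_add, ENNReal.ofReal_mul (Real.exp_nonneg _)]

lemma renewalFunction_lt_top (hpos : ∀ᵐ y ∂F, 0 ≤ y) (h0 : ¬ ∀ᵐ y ∂F, y = 0) (x : ℝ) :
    renewalFunction F x < ∞ := by
  refine (ENNReal.tsum_le_tsum fun n => convPow_Iic_le F n x).trans_lt ?_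
  rw [ENNReal.tsum_mul_left, ENNReal.tsum_geometric]
  refine ENNReal.mul_lt_top ENNReal.ofReal_lt_top (ENNReal.inv_lt_top.2 ?_)
  exact tsub_pos_of_lt (lintegral_exp_neg_lt_one F hpos h0)

lemma lintegral_Iic_renewalFunction_eq (x : ℝ) :
    ∫⁻ s in Set.Iic x, renewalFunction F s = ENNReal.ofReal x +
      ∫⁻ y, (∫⁻ s in Set.Iic (x - y), renewalFunction F s) ∂F := by
  have hN := (monotone_renewalFunction F).measurable
  rw [lintegral_congr fun s => renewalFunction_eq F s,
    lintegral_add_left (measurable_one.indicator measurableSet_Ici)]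
  congr 1
  · rw [lintegral_indicator_one measurableSet_Ici, Measure.restrict_apply measurableSet_Ici,
      Set.Ici_inter_Iic, Real.volume_Icc, sub_zero]
  · have hN2 : Measurable (Function.uncurry fun s y => renewalFunction F (s - y)) :=
      hN.comp (measurable_fst.sub measurable_snd)
    rw [lintegral_lintegral_swap hN2.aemeasurable]
    refine lintegral_congr fun y => ?_
    rw [← lintegral_indicator measurableSet_Iic, ← lintegral_indicator measurableSet_Iic,
      ← lintegral_sub_right_eq_self ((Set.Iic (x - y)).indicator (renewalFunction F)) y]
    refine lintegral_congr fun s => ?_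
    simp [Set.indicator]

omit [IsProbabilityMeasure F] in
-- The substitution `s = x - t` turns the window `(x - y, x]` into `[0, y)`, the range appearing in
-- `lintegral_tailMeasure`.
lemma lintegral_Iic_renewalFunction_add (x : ℝ) {y : ℝ} (hy : 0 ≤ y) :
    ∫⁻ s in Set.Iic x, renewalFunction F s =
      (∫⁻ s in Set.Iic (x - y), renewalFunction F s) +
        ∫⁻ t in Set.Ico 0 y, renewalFunction F (x - t) := by
  rw [← Set.Iic_union_Ioc_eq_Iic (sub_le_self x hy), lintegral_union measurableSet_Ioc
    (Set.Iic_disjoint_Ioc le_rfl)]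
  congr 1
  rw [← lintegral_indicator measurableSet_Ioc, ← lintegral_indicator measurableSet_Ico,
    ← lintegral_sub_left_eq_self _ x]
  refine lintegral_congr fun t => ?_
  simp [Set.indicator, and_comm]

lemma lintegral_Iic_renewalFunction_lt_top (hpos : ∀ᵐ y ∂F, 0 ≤ y) (h0 : ¬ ∀ᵐ y ∂F, y = 0)
    (x : ℝ) : ∫⁻ s in Set.Iic x, renewalFunction F s < ∞ := by
  calc ∫⁻ s in Set.Iic x, renewalFunction F s
      ≤ ∫⁻ s, (Set.Icc 0 x).indicator (fun _ => renewalFunction F x) s := by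
        rw [← lintegral_indicator measurableSet_Iic]
        refine lintegral_mono fun s => ?_
        rcases lt_or_ge s 0 with hs | hs
        · simp [Set.indicator, renewalFunction_of_neg F hpos hs]
        · by_cases hsx : s ≤ x
          · simpa [hs, hsx] using monotone_renewalFunction F hsx
          · simp [hsx]
    _ < ∞ := by
        rw [lintegral_indicator_const measurableSet_Icc, Real.volume_Icc]
        exact ENNReal.mul_lt_top (renewalFunction_lt_top F hpos h0 x) ENNReal.ofReal_lt_top

/-- The measure with density `t ↦ F (t, ∞)` on `[0, ∞)`. -/
noncomputable def tailMeasure (F : Measure ℝ) : Measure ℝ :=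
  ((F.prod volume).restrict {p : ℝ × ℝ | 0 ≤ p.2 ∧ p.2 < p.1}).map Prod.snd

omit [IsProbabilityMeasure F] in
-- Tonelli on the region `0 ≤ t < y`; moments and masses of the tail measure become integrals over
-- `F` without handling its density.
lemma lintegral_tailMeasure {f : ℝ → ℝ≥0∞} (hf : Measurable f) :
    ∫⁻ t, f t ∂tailMeasure F = ∫⁻ y, (∫⁻ t in Set.Ico 0 y, f t) ∂F := by
  have hs : MeasurableSet {p : ℝ × ℝ | 0 ≤ p.2 ∧ p.2 < p.1} :=
    (measurableSet_le measurable_const measurable_snd).inter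
      (measurableSet_lt measurable_snd measurable_fst)
  rw [tailMeasure, lintegral_map hf measurable_snd, ← lintegral_indicator hs,
    lintegral_prod _ (Measurable.indicator (by fun_prop) hs).aemeasurable]
  refine lintegral_congr fun y => ?_
  rw [← lintegral_indicator measurableSet_Ico]
  rfl

/-- The integrated renewal equation. -/
lemma lintegral_renewalFunction_tailMeasure (hpos : ∀ᵐ y ∂F, 0 ≤ y) (h0 : ¬ ∀ᵐ y ∂F, y = 0)
    (x : ℝ) :
    ∫⁻ t, renewalFunction F (x - t) ∂tailMeasure F = ENNReal.ofReal x := by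
  have hN := (monotone_renewalFunction F).measurable
  have hfin := (lintegral_Iic_renewalFunction_lt_top F hpos h0 x).ne
  have h1 := lintegral_Iic_renewalFunction_eq F x
  have hJ : Measurable fun y => ∫⁻ s in Set.Iic (x - y), renewalFunction F s :=
    Antitone.measurable fun a b hab =>
      lintegral_mono_set (Set.Iic_subset_Iic.2 (sub_le_sub_left hab x))
  have hNx : Measurable fun t => renewalFunction F (x - t) := hN.comp (measurable_const_sub x)
  rw [lintegral_tailMeasure F hNx]
  have h2 : ∫⁻ s in Set.Iic x, renewalFunction F s =
      (∫⁻ y, (∫⁻ s in Set.Iic (x - y), renewalFunction F s) ∂F) +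
        ∫⁻ y, (∫⁻ t in Set.Ico 0 y, renewalFunction F (x - t)) ∂F := by
    rw [← lintegral_add_left hJ]
    conv_lhs => rw [← mul_one (∫⁻ s in Set.Iic x, renewalFunction F s),
      ← measure_univ (μ := F), ← lintegral_const]
    exact lintegral_congr_ae (hpos.mono fun y hy => lintegral_Iic_renewalFunction_add F x hy)
  -- Both expressions for the integral of the renewal function contain this term; it must be finite
  -- to be cancelled in `ℝ≥0∞`.
  have hfin' : ∫⁻ y, (∫⁻ s in Set.Iic (x - y), renewalFunction F s) ∂F ≠ ∞ :=
    ne_top_of_le_ne_top hfin (h1 ▸ le_add_self)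
  rw [h2, add_comm, ENNReal.add_left_inj hfin'] at h1
  exact h1

end renewal

/-! ### The remainder of the renewal function: averages, sign, boundedness, limit. -/

section remainder

variable (F : Measure ℝ)

/-- The difference between the renewal function and its leading term `x⁺ / ∫ y dF(y)`. -/
noncomputable def renewalRemainder (x : ℝ) : ℝ :=
  (renewalFunction F x).toReal - max x 0 / ∫ y, y ∂F

lemma integrable_const_min {m : Measure ℝ} [IsFiniteMeasure m]
    (hint : Integrable (fun t => t) m) (x : ℝ) : Integrable (fun t => min x t) m :=
  (integrable_const x).inf hint

lemma tendsto_integral_min {m : Measure ℝ} (hm : ∀ᵐ t ∂m, 0 ≤ t)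
    (hint : Integrable (fun t => t) m) :
    Tendsto (fun x => ∫ t, min x t ∂m) atTop (𝓝 (∫ t, t ∂m)) := by
  refine tendsto_integral_filter_of_dominated_convergence (fun t => |t|)
    (.of_forall fun x => by fun_prop) ?_ hint.abs (ae_of_all _ fun t => ?_)
  · filter_upwards [eventually_ge_atTop (0 : ℝ)] with x hx
    filter_upwards [hm] with t ht
    rw [Real.norm_eq_abs, abs_of_nonneg (le_min hx ht), abs_of_nonneg ht]
    exact min_le_right _ _
  · refine tendsto_const_nhds.congr' ?_
    filter_upwards [eventually_ge_atTop t] with x hx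
    exact (min_eq_right hx).symm

lemma integral_id_pos (hpos : ∀ᵐ y ∂F, 0 ≤ y) (h0 : ¬ ∀ᵐ y ∂F, y = 0)
    (hint : Integrable (fun y => y) F) : 0 < ∫ y, y ∂F := by
  refine lt_of_le_of_ne (integral_nonneg_of_ae hpos) fun h => h0 ?_
  exact (integral_eq_zero_iff_of_nonneg_ae hpos hint).1 h.symm

lemma ae_tailMeasure_nonneg : ∀ᵐ t ∂tailMeasure F, 0 ≤ t := by
  have hs : MeasurableSet {p : ℝ × ℝ | 0 ≤ p.2 ∧ p.2 < p.1} :=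
    (measurableSet_le measurable_const measurable_snd).inter
      (measurableSet_lt measurable_snd measurable_fst)
  rw [tailMeasure, ae_map_iff measurable_snd.aemeasurable measurableSet_Ici]
  filter_upwards [ae_restrict_mem hs] with p hp using hp.1

lemma tailMeasure_univ (hpos : ∀ᵐ y ∂F, 0 ≤ y) (hint : Integrable (fun y => y) F) :
    tailMeasure F Set.univ = ENNReal.ofReal (∫ y, y ∂F) := by
  rw [← lintegral_one, lintegral_tailMeasure F measurable_const,
    ofReal_integral_eq_lintegral_ofReal hint hpos]
  simp

lemma isFiniteMeasure_tailMeasure (hpos : ∀ᵐ y ∂F, 0 ≤ y) (hint : Integrable (fun y => y) F) :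
    IsFiniteMeasure (tailMeasure F) :=
  ⟨by rw [tailMeasure_univ F hpos hint]; exact ENNReal.ofReal_lt_top⟩

lemma lintegral_ofReal_tailMeasure (hpos : ∀ᵐ y ∂F, 0 ≤ y)
    (hsq : Integrable (fun y => y ^ 2) F) :
    ∫⁻ t, ENNReal.ofReal t ∂tailMeasure F = ENNReal.ofReal ((∫ y, y ^ 2 ∂F) / 2) := by
  rw [lintegral_tailMeasure F ENNReal.measurable_ofReal, ← integral_div,
    ofReal_integral_eq_lintegral_ofReal (hsq.div_const 2) (ae_of_all _ fun y => by positivity)]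
  refine lintegral_congr_ae (hpos.mono fun y hy => ?_)
  have hi : IntegrableOn (fun t : ℝ => t) (Set.Ico 0 y) :=
    (continuous_id.integrableOn_Icc).mono_set Set.Ico_subset_Icc_self
  simp only
  rw [← ofReal_integral_eq_lintegral_ofReal hi
    ((ae_restrict_mem measurableSet_Ico).mono fun t ht => ht.1), integral_Ico_eq_integral_Ioc,
    ← intervalIntegral.integral_of_le hy, integral_id]
  simp

lemma integrable_id_tailMeasure (hpos : ∀ᵐ y ∂F, 0 ≤ y)
    (hsq : Integrable (fun y => y ^ 2) F) : Integrable (fun t => t) (tailMeasure F) := by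
  refine ⟨by fun_prop, ?_⟩
  rw [hasFiniteIntegral_iff_ofReal (ae_tailMeasure_nonneg F),
    lintegral_ofReal_tailMeasure F hpos hsq]
  exact ENNReal.ofReal_lt_top

lemma integral_id_tailMeasure (hpos : ∀ᵐ y ∂F, 0 ≤ y)
    (hsq : Integrable (fun y => y ^ 2) F) :
    ∫ t, t ∂tailMeasure F = (∫ y, y ^ 2 ∂F) / 2 := by
  rw [integral_eq_lintegral_of_nonneg_ae (ae_tailMeasure_nonneg F) (by fun_prop),
    lintegral_ofReal_tailMeasure F hpos hsq, ENNReal.toReal_ofReal (by positivity)]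

/-- For `y ≥ 0` the inner integral over `[0, y)` is `min 1 y`, which vanishes only at `y = 0`. -/
lemma tailMeasure_Ico_pos (hpos : ∀ᵐ y ∂F, 0 ≤ y) (h0 : ¬ ∀ᵐ y ∂F, y = 0) :
    0 < tailMeasure F (Set.Ico 0 1) := by
  refine pos_iff_ne_zero.2 fun h => h0 ?_
  rw [← lintegral_indicator_one measurableSet_Ico,
    lintegral_tailMeasure F (measurable_one.indicator measurableSet_Ico)] at h
  simp_rw [lintegral_indicator_one measurableSet_Ico,
    Measure.restrict_apply measurableSet_Ico, Set.Ico_inter_Ico, Real.volume_Ico] at h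
  rw [lintegral_eq_zero_iff (by fun_prop)] at h
  filter_upwards [h, hpos] with y hy hy0
  simp only [max_self, sub_zero, Pi.zero_apply, ENNReal.ofReal_eq_zero, inf_le_iff] at hy
  rcases hy with hy | hy
  · norm_num at hy
  · exact le_antisymm hy hy0

lemma measurable_renewalRemainder : Measurable (renewalRemainder F) :=
  (monotone_renewalFunction F).measurable.ennreal_toReal.sub
    ((measurable_id.max measurable_const).div_const _)

variable [IsProbabilityMeasure F]

lemma integrable_renewalFunction_sub (hpos : ∀ᵐ y ∂F, 0 ≤ y) (h0 : ¬ ∀ᵐ y ∂F, y = 0)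
    (m : Measure ℝ) [IsFiniteMeasure m] (hm : ∀ᵐ t ∂m, 0 ≤ t) (x : ℝ) :
    Integrable (fun t => (renewalFunction F (x - t)).toReal) m := by
  refine Integrable.of_bound (C := (renewalFunction F x).toReal)
    (((monotone_renewalFunction F).measurable.comp
      (measurable_const_sub x)).ennreal_toReal.aestronglyMeasurable) (hm.mono fun t ht => ?_)
  rw [Real.norm_eq_abs, abs_of_nonneg ENNReal.toReal_nonneg]
  exact ENNReal.toReal_mono (renewalFunction_lt_top F hpos h0 x).ne
    (monotone_renewalFunction F (by linarith))

/-- For `t ≥ 0`, `(x - t)⁺ = x⁺ - min(x⁺, t)`; this form exposes the truncated mean, which converges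
as `x → ∞`. -/
lemma smear_renewalRemainder (hpos : ∀ᵐ y ∂F, 0 ≤ y) (h0 : ¬ ∀ᵐ y ∂F, y = 0)
    (m : Measure ℝ) [IsFiniteMeasure m] (hm : ∀ᵐ t ∂m, 0 ≤ t)
    (hint : Integrable (fun t => t) m) (x : ℝ) :
    smear m (renewalRemainder F) x = (∫⁻ t, renewalFunction F (x - t) ∂m).toReal -
      ((∫ t, (max x 0 - min (max x 0) t) ∂m) / ∫ y, y ∂F) := by
  have hI := integrable_renewalFunction_sub F hpos h0 m hm x
  have hmin : Integrable (fun t => max x 0 - min (max x 0) t) m :=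
    (integrable_const _).sub (integrable_const_min hint _)
  have h1 : smear m (renewalRemainder F) x = ∫ t, ((renewalFunction F (x - t)).toReal -
      (max x 0 - min (max x 0) t) / ∫ y, y ∂F) ∂m := by
    refine integral_congr_ae (hm.mono fun t ht => ?_)
    simp only [renewalRemainder]
    congr 2
    rcases le_total x 0 with hx | hx
    · rw [max_eq_right hx, min_eq_left ht, max_eq_right (by linarith), sub_zero]
    · rw [max_eq_left hx]
      rcases le_total x t with hxt | hxt
      · rw [min_eq_left hxt, max_eq_right (by linarith), sub_self]
      · rw [min_eq_right hxt, max_eq_left (by linarith)]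
  have hmeas : Measurable fun t => renewalFunction F (x - t) :=
    (monotone_renewalFunction F).measurable.comp (measurable_const_sub x)
  rw [h1, integral_sub hI (hmin.div_const _), integral_div,
    integral_toReal hmeas.aemeasurable
      (ae_of_all _ fun t => renewalFunction_lt_top F hpos h0 _)]

lemma renewalRemainder_of_neg (hpos : ∀ᵐ y ∂F, 0 ≤ y) {x : ℝ} (hx : x < 0) :
    renewalRemainder F x = 0 := by
  simp [renewalRemainder, renewalFunction_of_neg F hpos hx, max_eq_right hx.le]

lemma renewalRemainder_sub_smear (hpos : ∀ᵐ y ∂F, 0 ≤ y) (h0 : ¬ ∀ᵐ y ∂F, y = 0)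
    (hint : Integrable (fun y => y) F) {x : ℝ} (hx : 0 ≤ x) :
    renewalRemainder F x - smear F (renewalRemainder F) x =
      1 - (∫ y, min x y ∂F) / ∫ y, y ∂F := by
  have hfin : ∫⁻ y, renewalFunction F (x - y) ∂F ≠ ∞ := by
    refine ne_top_of_le_ne_top (renewalFunction_lt_top F hpos h0 x).ne ?_
    rw [renewalFunction_eq]
    exact le_add_self
  rw [smear_renewalRemainder F hpos h0 F hpos hint, renewalRemainder, renewalFunction_eq,
    ENNReal.toReal_add (by simp [hx]) hfin, max_eq_left hx,
    integral_sub (integrable_const _) (integrable_const_min hint _)]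
  simp [hx]
  ring

lemma smear_renewalRemainder_le (hpos : ∀ᵐ y ∂F, 0 ≤ y) (h0 : ¬ ∀ᵐ y ∂F, y = 0)
    (hint : Integrable (fun y => y) F) (x : ℝ) :
    smear F (renewalRemainder F) x ≤ renewalRemainder F x := by
  rcases lt_or_ge x 0 with hx | hx
  · rw [renewalRemainder_of_neg F hpos hx]
    refine (integral_eq_zero_of_ae (hpos.mono fun y hy => ?_)).le
    exact renewalRemainder_of_neg F hpos (by linarith)
  · rw [← sub_nonneg, renewalRemainder_sub_smear F hpos h0 hint hx, sub_nonneg,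
      div_le_one (integral_id_pos F hpos h0 hint)]
    exact integral_mono (integrable_const_min hint _) hint fun y => min_le_right _ _

lemma integrable_renewalRemainder_sub (hpos : ∀ᵐ y ∂F, 0 ≤ y) (h0 : ¬ ∀ᵐ y ∂F, y = 0)
    (m : Measure ℝ) [IsFiniteMeasure m] (hm : ∀ᵐ t ∂m, 0 ≤ t)
    (hint : Integrable (fun t => t) m) (x : ℝ) :
    Integrable (fun t => renewalRemainder F (x - t)) m :=
  (integrable_renewalFunction_sub F hpos h0 m hm x).sub
    ((((integrable_const x).sub hint).sup (integrable_const 0)).div_const _)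

/-- On `(-∞, x₀]` the remainder is at least `-x₀/μ` times the indicator of `[0, ∞)`, where `μ` is
the mean. Superharmonicity lets this bound be smeared `n` times; jumps being nonnegative, the
argument never leaves `(-∞, x₀]`. -/
lemma neg_mul_convPow_le_renewalRemainder (hpos : ∀ᵐ y ∂F, 0 ≤ y) (h0 : ¬ ∀ᵐ y ∂F, y = 0)
    (hint : Integrable (fun y => y) F) {x₀ : ℝ} (n : ℕ) {x : ℝ} (hx : x ≤ x₀) :
    -(x₀ / ∫ y, y ∂F) * (convPow F n).real (Set.Iic x) ≤ renewalRemainder F x := by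
  have hmean := integral_id_pos F hpos h0 hint
  induction n generalizing x with
  | zero =>
    rcases lt_or_ge x 0 with hx0 | hx0
    · simp [renewalRemainder_of_neg F hpos hx0, measureReal_def, convPow_zero_Iic, hx0]
    · have : x / ∫ y, y ∂F ≤ x₀ / ∫ y, y ∂F := by gcongr
      have h1 : 0 ≤ (renewalFunction F x).toReal := ENNReal.toReal_nonneg
      simp only [measureReal_def, convPow_zero_Iic, Set.mem_Ici, hx0, Set.indicator_of_mem,
        Pi.one_apply, ENNReal.toReal_one, mul_one, renewalRemainder, max_eq_left]
      linarith
  | succ n ih =>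
    refine le_trans ?_ (smear_renewalRemainder_le F hpos h0 hint x)
    have hmeas := (measurable_convPow_Iic F n).comp (measurable_const_sub x)
    have h1 : (convPow F (n + 1)).real (Set.Iic x) =
        ∫ y, (convPow F n).real (Set.Iic (x - y)) ∂F := by
      rw [measureReal_def, convPow_succ_Iic]
      exact (integral_toReal hmeas.aemeasurable (ae_of_all _ fun y => measure_lt_top _ _)).symm
    rw [h1, ← integral_const_mul]
    refine integral_mono_ae (Integrable.const_mul (Integrable.of_bound (C := 1)
      hmeas.ennreal_toReal.aestronglyMeasurable (ae_of_all _ fun y => ?_)) _)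
      (integrable_renewalRemainder_sub F hpos h0 F hpos hint x)
      (hpos.mono fun y hy => ih (by linarith))
    simp only [Function.comp, Real.norm_eq_abs, abs_of_nonneg ENNReal.toReal_nonneg]
    exact measureReal_le_one

/-- The terms of the convergent renewal series tend to zero, so the iterated lower bound tends to
`0`. -/
lemma renewalRemainder_nonneg (hpos : ∀ᵐ y ∂F, 0 ≤ y) (h0 : ¬ ∀ᵐ y ∂F, y = 0)
    (hint : Integrable (fun y => y) F) (x : ℝ) : 0 ≤ renewalRemainder F x := by
  rcases lt_or_ge x 0 with hx | hx
  · rw [renewalRemainder_of_neg F hpos hx]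
  have h := ENNReal.tendsto_atTop_zero_of_tsum_ne_top (renewalFunction_lt_top F hpos h0 x).ne
  have h' : Tendsto (fun n => (convPow F n).real (Set.Iic x)) atTop (𝓝 0) :=
    (ENNReal.tendsto_toReal ENNReal.zero_ne_top).comp h
  have h'' := h'.const_mul (-(x / ∫ y, y ∂F))
  rw [mul_zero] at h''
  exact le_of_tendsto h'' (.of_forall fun n =>
    neg_mul_convPow_le_renewalRemainder F hpos h0 hint n le_rfl)

lemma monotoneOn_renewalRemainder_add (hpos : ∀ᵐ y ∂F, 0 ≤ y) (h0 : ¬ ∀ᵐ y ∂F, y = 0) :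
    MonotoneOn (fun x => renewalRemainder F x + (∫ y, y ∂F)⁻¹ * x) (Set.Ici 0) := by
  intro a ha b hb hab
  have : (renewalFunction F a).toReal ≤ (renewalFunction F b).toReal :=
    ENNReal.toReal_mono (renewalFunction_lt_top F hpos h0 b).ne (monotone_renewalFunction F hab)
  simp only [renewalRemainder, max_eq_left (Set.mem_Ici.1 ha), max_eq_left (Set.mem_Ici.1 hb),
    div_eq_inv_mul]
  linarith

lemma smear_tailMeasure_renewalRemainder (hpos : ∀ᵐ y ∂F, 0 ≤ y) (h0 : ¬ ∀ᵐ y ∂F, y = 0)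
    (hint : Integrable (fun y => y) F) (hsq : Integrable (fun y => y ^ 2) F)
    {x : ℝ} (hx : 0 ≤ x) :
    smear (tailMeasure F) (renewalRemainder F) x =
      (∫ t, min x t ∂tailMeasure F) / ∫ y, y ∂F := by
  have hmean := integral_id_pos F hpos h0 hint
  have := isFiniteMeasure_tailMeasure F hpos hint
  have hi := integrable_id_tailMeasure F hpos hsq
  rw [smear_renewalRemainder F hpos h0 _ (ae_tailMeasure_nonneg F) hi,
    lintegral_renewalFunction_tailMeasure F hpos h0 x, max_eq_left hx,
    integral_sub (integrable_const _) (integrable_const_min hi _), integral_const,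
    measureReal_def, tailMeasure_univ F hpos hint, ENNReal.toReal_ofReal hx,
    ENNReal.toReal_ofReal hmean.le, smul_eq_mul]
  field_simp
  ring

/-- A large value at `x` persists, up to a loss of one inverse mean, on `(x, x + 1]`. The tail
average at `x + 1` gives this interval the fixed mass `q`. As the remainder is nonnegative nothing
cancels, and that average is at most `B`. -/
lemma isBoundedMeasurable_renewalRemainder (hpos : ∀ᵐ y ∂F, 0 ≤ y) (h0 : ¬ ∀ᵐ y ∂F, y = 0)
    (hint : Integrable (fun y => y) F) (hsq : Integrable (fun y => y ^ 2) F) :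
    IsBoundedMeasurable (renewalRemainder F) := by
  have hmean := integral_id_pos F hpos h0 hint
  have := isFiniteMeasure_tailMeasure F hpos hint
  have hi := integrable_id_tailMeasure F hpos hsq
  set q := (tailMeasure F).real (Set.Ico 0 1) with hq_def
  have hq : 0 < q :=
    ENNReal.toReal_pos (tailMeasure_Ico_pos F hpos h0).ne' (measure_ne_top _ _)
  set B := (∫ t, t ∂tailMeasure F) / ∫ y, y ∂F
  have hB : 0 ≤ B := div_nonneg (integral_nonneg_of_ae (ae_tailMeasure_nonneg F)) hmean.le
  have hnn := renewalRemainder_nonneg F hpos h0 hint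
  refine ⟨measurable_renewalRemainder F, B / q + (∫ y, y ∂F)⁻¹, fun x => ?_⟩
  rw [abs_of_nonneg (hnn x)]
  rcases lt_or_ge x 0 with hx | hx
  · rw [renewalRemainder_of_neg F hpos hx]
    positivity
  have hI := integrable_renewalRemainder_sub F hpos h0 _ (ae_tailMeasure_nonneg F) hi (x + 1)
  have key : q * (renewalRemainder F x - (∫ y, y ∂F)⁻¹) ≤ B := by
    calc q * (renewalRemainder F x - (∫ y, y ∂F)⁻¹)
        = ∫ t in Set.Ico 0 1, (renewalRemainder F x - (∫ y, y ∂F)⁻¹) ∂tailMeasure F := by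
          simp [hq_def]
      _ ≤ ∫ t in Set.Ico 0 1, renewalRemainder F (x + 1 - t) ∂tailMeasure F := by
          refine setIntegral_mono_on (integrable_const _).integrableOn hI.integrableOn
            measurableSet_Ico fun t ht => ?_
          have h := monotoneOn_renewalRemainder_add F hpos h0 (a := x) (b := x + 1 - t) hx
            (by simp; linarith [ht.2]) (by linarith [ht.2])
          simp only at h
          have := mul_nonneg (inv_nonneg.2 hmean.le) ht.1
          linarith
      _ ≤ smear (tailMeasure F) (renewalRemainder F) (x + 1) :=
          setIntegral_le_integral hI (ae_of_all _ fun t => hnn _)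
      _ ≤ B := by
          rw [smear_tailMeasure_renewalRemainder F hpos h0 hint hsq (by linarith)]
          exact div_le_div_of_nonneg_right (integral_mono (integrable_const_min hi _) hi
            fun t => min_le_right _ _) hmean.le
  rw [← sub_le_iff_le_add, le_div_iff₀ hq, mul_comm]
  exact key

/-- The second-order asymptotics of the renewal function. -/
theorem tendsto_renewalRemainder (hpos : ∀ᵐ y ∂F, 0 ≤ y)
    (hF : ∀ d : ℝ, 0 < d → ¬ ∀ᵐ y ∂F, ∃ k : ℤ, y = k * d)
    (hint : Integrable (fun y => y) F) (hsq : Integrable (fun y => y ^ 2) F) :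
    Tendsto (renewalRemainder F) atTop
      (𝓝 ((∫ y, y ^ 2 ∂F) / (2 * (∫ y, y ∂F) ^ 2))) := by
  have h0 : ¬ ∀ᵐ y ∂F, y = 0 := fun h => hF 1 one_pos (h.mono fun y hy => ⟨0, by simp [hy]⟩)
  have hmean := integral_id_pos F hpos h0 hint
  have := isFiniteMeasure_tailMeasure F hpos hint
  have hi := integrable_id_tailMeasure F hpos hsq
  have huniv : (tailMeasure F).real Set.univ = ∫ y, y ∂F := by
    rw [measureReal_def, tailMeasure_univ F hpos hint, ENNReal.toReal_ofReal hmean.le]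
  have hlim : Tendsto (fun x => renewalRemainder F x - smear F (renewalRemainder F) x) atTop
      (𝓝 0) := by
    have h := ((tendsto_integral_min hpos hint).div_const (∫ y, y ∂F)).const_sub 1
    rw [div_self hmean.ne', sub_self] at h
    refine h.congr' ?_
    filter_upwards [eventually_ge_atTop (0 : ℝ)] with x hx
    exact (renewalRemainder_sub_smear F hpos h0 hint hx).symm
  have hL : Tendsto (smear (tailMeasure F) (renewalRemainder F)) atTop
      (𝓝 ((∫ y, y ^ 2 ∂F) / 2 / ∫ y, y ∂F)) := by
    rw [← integral_id_tailMeasure F hpos hsq]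
    refine ((tendsto_integral_min (ae_tailMeasure_nonneg F) hi).div_const _).congr' ?_
    filter_upwards [eventually_ge_atTop (0 : ℝ)] with x hx
    exact (smear_tailMeasure_renewalRemainder F hpos h0 hint hsq hx).symm
  have h := tendsto_of_tendsto_smear F hF (tailMeasure F) (huniv ▸ hmean)
    (isBoundedMeasurable_renewalRemainder F hpos h0 hint hsq) (inv_pos.2 hmean) hlim hL
    (monotoneOn_renewalRemainder_add F hpos h0)
  rw [huniv] at h
  convert h using 2
  field_simp

end remainder

/-! ### Expected first-passage count as renewal function. -/

section firstPassage

variable {Ω : Type*} {Y : ℕ → Ω → ℝ}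

/-- Partial sums are nondecreasing, so the `n` with sum at most `x` form an initial segment of
length `M(x)`. The index `n = 0` is counted, matching the term `convPow F 0` of the renewal series.
-/
lemma firstPassageCount_eq_tsum {x : ℝ} {ω : Ω} (h : ∀ i, 0 ≤ Y i ω) :
    (firstPassageCount Y x ω : ℝ≥0∞) =
      ∑' n : ℕ, {n : ℕ | ∑ i ∈ Finset.range n, Y i ω ≤ x}.indicator 1 n := by
  have hmono : Monotone fun n => ∑ i ∈ Finset.range n, Y i ω := fun a b hab =>
    Finset.sum_le_sum_of_subset_of_nonneg (Finset.range_mono hab) fun i _ _ => h i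
  by_cases hex : ∃ n, x < ∑ i ∈ Finset.range n, Y i ω
  · classical
    have hcount : firstPassageCount Y x ω = (Nat.find hex : ℕ∞) := by
      refine le_antisymm (iInf₂_le (Nat.find hex) (Nat.find_spec hex)) (le_iInf₂ fun n hn => ?_)
      exact_mod_cast Nat.find_min' hex hn
    have hset : {n : ℕ | ∑ i ∈ Finset.range n, Y i ω ≤ x} = Finset.range (Nat.find hex) := by
      ext n
      simp only [Set.mem_ofPred_eq, Finset.coe_range, Set.mem_Iio, Nat.lt_find_iff, not_lt]
      exact ⟨fun hn k hk => (hmono hk).trans hn, fun hn => hn n le_rfl⟩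
    rw [hcount, hset, ← tsum_subtype]
    simp
  · have hcount : firstPassageCount Y x ω = ⊤ := by
      simp only [firstPassageCount, iInf_eq_top]
      exact fun n hn => absurd ⟨n, hn⟩ hex
    have hset : {n : ℕ | ∑ i ∈ Finset.range n, Y i ω ≤ x} = Set.univ := by
      simp only [not_exists, not_lt] at hex
      exact Set.eq_univ_of_forall hex
    rw [hcount, hset]
    simp

variable [MeasurableSpace Ω] {P : Measure Ω} [IsProbabilityMeasure P]

lemma map_sum_range_eq_convPow (hindep : iIndepFun Y P)
    (hident : ∀ i, IdentDistrib (Y i) (Y 0) P P) (n : ℕ) :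
    P.map (fun ω => ∑ i ∈ Finset.range n, Y i ω) = convPow (P.map (Y 0)) n := by
  have hY : ∀ i, AEMeasurable (Y i) P := fun i => (hident i).aemeasurable_fst
  induction n with
  | zero => simp [convPow, Measure.map_const]
  | succ n ih =>
    have : IsProbabilityMeasure (P.map (Y 0)) := Measure.isProbabilityMeasure_map (hY 0)
    have hind : IndepFun (fun ω => ∑ i ∈ Finset.range n, Y i ω) (Y n) P := by
      have := hindep.indepFun_sum_range_succ₀ hY n
      convert this using 1
      ext ω
      simp
    have hS : AEMeasurable (fun ω => ∑ i ∈ Finset.range n, Y i ω) P := by fun_prop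
    have := hind.map_add_eq_map_conv_map₀ hS (hY n)
    rw [ih, (hident n).map_eq, Measure.conv_comm] at this
    simp_rw [Finset.sum_range_succ]
    exact this

lemma expectedCount_eq_renewalFunction (hindep : iIndepFun Y P)
    (hident : ∀ i, IdentDistrib (Y i) (Y 0) P P) (hnonneg : ∀ᵐ ω ∂P, 0 ≤ Y 0 ω) (x : ℝ) :
    expectedCount P Y x = renewalFunction (P.map (Y 0)) x := by
  have hY : ∀ i, AEMeasurable (Y i) P := fun i => (hident i).aemeasurable_fst
  have hS : ∀ n, AEMeasurable (fun ω => ∑ i ∈ Finset.range n, Y i ω) P := fun n => by fun_prop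
  have hpos : ∀ᵐ ω ∂P, ∀ i, 0 ≤ Y i ω := ae_all_iff.2 fun i =>
    (hident i).symm.ae_snd measurableSet_Ici hnonneg
  have hind : ∀ n, NullMeasurableSet {ω | ∑ i ∈ Finset.range n, Y i ω ≤ x} P := fun n =>
    (hS n).nullMeasurable measurableSet_Iic
  calc expectedCount P Y x
      = ∫⁻ ω, ∑' n : ℕ, {ω | ∑ i ∈ Finset.range n, Y i ω ≤ x}.indicator 1 ω ∂P :=
        lintegral_congr_ae (hpos.mono fun ω hω => firstPassageCount_eq_tsum hω)
    _ = ∑' n : ℕ, P {ω | ∑ i ∈ Finset.range n, Y i ω ≤ x} := by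
        have hone : ∀ n, AEMeasurable
            ({ω | ∑ i ∈ Finset.range n, Y i ω ≤ x}.indicator (1 : Ω → ℝ≥0∞)) P := fun n =>
          measurable_one.aemeasurable.indicator₀ (hind n)
        rw [lintegral_tsum hone]
        exact tsum_congr fun n => lintegral_indicator_one₀ (hind n)
    _ = renewalFunction (P.map (Y 0)) x := by
        refine tsum_congr fun n => ?_
        rw [← map_sum_range_eq_convPow hindep hident,
          Measure.map_apply_of_aemeasurable (hS n) measurableSet_Iic]
        rfl

end firstPassage

/-! ### The main theorem, transferred from the law of one hop. -/

theorem theorem4 {Ω : Type*} [MeasurableSpace Ω] (P : Measure Ω) [IsProbabilityMeasure P]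
    (Y : ℕ → Ω → ℝ)
    (hindep : iIndepFun Y P)
    (hident : ∀ i, IdentDistrib (Y i) (Y 0) P P)
    (hnonneg : ∀ᵐ ω ∂P, 0 ≤ Y 0 ω)
    (hmoment : MemLp (Y 0) 2 P)
    (hnonarith : ¬ IsArithmetic P (Y 0)) :
    (∀ x : ℝ, expectedCount P Y x < ∞) ∧
    Tendsto (fun x : ℝ => (expectedCount P Y x).toReal - x / (∫ ω, Y 0 ω ∂P)) atTop
      (𝓝 ((∫ ω, (Y 0 ω) ^ 2 ∂P) / (2 * (∫ ω, Y 0 ω ∂P) ^ 2))) := by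
  have hY : AEMeasurable (Y 0) P := (hident 0).aemeasurable_fst
  have : IsProbabilityMeasure (P.map (Y 0)) := Measure.isProbabilityMeasure_map hY
  have hpos : ∀ᵐ y ∂P.map (Y 0), 0 ≤ y := (ae_map_iff hY measurableSet_Ici).2 hnonneg
  have hF : ∀ d : ℝ, 0 < d → ¬ ∀ᵐ y ∂P.map (Y 0), ∃ k : ℤ, y = k * d := fun d hd h =>
    hnonarith ⟨d, hd, ae_of_ae_map hY h⟩
  have hint : Integrable (fun y => y) (P.map (Y 0)) :=
    (integrable_map_measure (by fun_prop) hY).2 (hmoment.integrable one_le_two)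
  have hsq : Integrable (fun y => y ^ 2) (P.map (Y 0)) :=
    (integrable_map_measure (by fun_prop) hY).2 hmoment.integrable_sq
  have h0 : ¬ ∀ᵐ y ∂P.map (Y 0), y = 0 := fun h =>
    hF 1 one_pos (h.mono fun y hy => ⟨0, by simp [hy]⟩)
  have hcount := expectedCount_eq_renewalFunction hindep hident hnonneg
  refine ⟨fun x => (hcount x).trans_lt (renewalFunction_lt_top _ hpos h0 x), ?_⟩
  have h := tendsto_renewalRemainder _ hpos hF hint hsq
  rw [integral_map hY (by fun_prop), integral_map hY (by fun_prop)] at h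
  refine h.congr' ?_
  filter_upwards [eventually_ge_atTop (0 : ℝ)] with x hx
  rw [hcount, renewalRemainder, max_eq_left hx, integral_map hY (by fun_prop)]
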